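/- Let $k<n$ be positive integers. A partition of the cake $[0,1]$ into $k$ intervals is given by cut points $0=c_0\le c_1\le\dots\le c_k=1$; its $j$-th piece is $[c_{j-1},c_j]$ (possibly of length zero), and the set of all partitions carries the topology of convergence of the cut points. There are $n$ guests; in each partition, each guest lists some of the $k$ pieces as favorites (possibly several, possibly none). For $i\in\{1,\dots,n\}$ and $j\in\{1,\dots,k\}$ let $A^i_j$ be the set of partitions in which the $j$-th piece is one of the favorites of guest $i$. Assume that the guests are $(k+1)$-hungry, that is: - for every partition of $[0,1]$ into $k$ intervals and any $n-k$ of the guests, at least one of these guests lists among their favorites a piece of positive length; and - each set $A^i_j$ is closed. Then there exists a partition of $[0,1]$ into $k$ intervals such that, whichever single guest is excluded, the $k$ pieces can be distributed among $k$ different remaining guests, one piece to each, so that each of them receives one of their favorite pieces. -/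

import Mathlib

namespace CakeCutting

/-- A partition of the cake `[0,1]` into `k` (possibly degenerate) intervals, listed from left to
right, is given by its cut points `0 = c 0 ≤ c 1 ≤ ⋯ ≤ c k = 1`; the `j`-th piece is the interval
`[c j, c (j + 1)]` for `j = 0, …, k - 1`. -/
def partitions (k : ℕ) : Set (Fin (k + 1) → ℝ) :=
  {c | Monotone c ∧ c 0 = 0 ∧ c (Fin.last k) = 1}

/-- The type of partitions of `[0,1]` into `k` intervals, with the topology of convergence of the
cut points (equivalently, of the vector of lengths of the pieces). -/
abbrev Partition (k : ℕ) : Type := partitions k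

/-- The length of the `j`-th piece. -/
def Partition.length {k : ℕ} (P : Partition k) (j : Fin k) : ℝ :=
  P.1 j.succ - P.1 j.castSucc

/-- The preferences of `n` guests: `A i j` is the set of the partitions in which the `j`-th piece
is one of the favorite pieces of guest `i`. A guest may have several favorite pieces in a
partition, or none at all (the guest then rejects the partition). -/
abbrev Preferences (n k : ℕ) : Type := Fin n → Fin k → Set (Partition k)

/-- The `n` guests are `α`-hungry (for `1 ≤ α ≤ n`): for every partition, among any `n - α + 1`
guests someone has a favorite piece of positive length; and all preference sets are closed. -/
def IsHungry {n k : ℕ} (α : ℕ) (A : Preferences n k) : Prop :=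
  (∀ P : Partition k, ∀ C : Finset (Fin n), C.card + α = n + 1 →
    ∃ i ∈ C, ∃ j : Fin k, 0 < P.length j ∧ P ∈ A i j) ∧
  ∀ i j, IsClosed (A i j)

/-- The pieces of `P` can be distributed, one each, among `k` different guests of the set `S`, such
that each of these receives one of their favorite pieces: guest `π j` receives the `j`-th piece. -/
def EnvyFreeAmong {n k : ℕ} (A : Preferences n k) (P : Partition k) (S : Set (Fin n)) : Prop :=
  ∃ π : Fin k → Fin n, Function.Injective π ∧ ∀ j, π j ∈ S ∧ P ∈ A (π j) j

end CakeCutting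

/-! Hunger means that at every partition at least `k + 1` guests like some piece of positive length
(`IsHungry.card_hungry`). Let each of them put mass 1 on one such piece. After enlarging the
preferences by `ε`, this assignment stays valid nearby, and the valid fractional assignments form a
convex set, so the local choices glue to a continuous family of fractional assignments with total
mass at least `k + 1`. Some piece then gets at least the average `(k + 1) / k`, and it has positive
length because empty pieces get nothing. The KKM lemma `exists_mem_all_of_closed_cover` yields one
partition where every piece gets that much.

There, any nonempty set of `J` pieces carries mass greater than `|J|`, while each guest supplies at
most 1. So more than `|J|` guests like a piece of `J`: Hall's condition with one guest to spare.
Compactness and closedness remove `ε` (`IsHungry.exists_strict_hall`). Excluding a guest costs at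
most one, so Hall's marriage theorem still applies, at the same partition for every exclusion.

KKM rests on Sperner's lemma `exists_full_cell`, proved by relabelling lattice points one at a time:
the parity of the number of full cells is preserved, starting from a labelling with exactly one. -/

namespace CakeCutting

open Finset Equiv

/-! ### Sperner's lemma: geometry of the cyclic triangulation -/

section Sperner

variable {k : ℕ} [NeZero k]

/-- The `i`-th vertex of the cell of the cyclic Freudenthal triangulation of `ℤ^k` with base point
`w` and order `τ`: walking around the cell, the unit move from coordinate `c` to `c + 1` is made at
time `τ c`. -/
def vertex (w : Fin k → ℤ) (τ : Perm (Fin k)) (i : Fin k) : Fin k → ℤ := fun c =>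
  w c + (if τ (c - 1) < i then 1 else 0) - (if τ c < i then 1 else 0)

lemma vertex_zero (w : Fin k → ℤ) (τ : Perm (Fin k)) : vertex w τ 0 = w := by
  funext c
  simp [vertex]

lemma sum_vertex (w : Fin k → ℤ) (τ : Perm (Fin k)) (i : Fin k) :
    ∑ c, vertex w τ i c = ∑ c, w c := by
  have h : ∑ c : Fin k, (if τ (c - 1) < i then (1 : ℤ) else 0) =
      ∑ c, if τ c < i then (1 : ℤ) else 0 :=
    Equiv.sum_comp (Equiv.subRight (1 : Fin k)) (fun c => if τ c < i then (1 : ℤ) else 0)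
  simp only [vertex, Finset.sum_sub_distrib, Finset.sum_add_distrib, h]
  ring

lemma vertex_le_add_one (w : Fin k → ℤ) (τ : Perm (Fin k)) (i j c : Fin k) :
    vertex w τ i c ≤ vertex w τ j c + 1 := by
  simp only [vertex, Fin.lt_def]
  split_ifs <;> omega

/-- Returning to `w` would make `τ c < i` independent of `c` around the cycle, but it holds for the
move made at time 0 and fails for the one made at time `i`. -/
lemma vertex_ne (w : Fin k → ℤ) (τ : Perm (Fin k)) {i : Fin k} (hi : i ≠ 0) :
    vertex w τ i ≠ w := by
  intro h
  have hstep : ∀ c, τ (c + 1) < i ↔ τ c < i := by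
    intro c
    have h1 := congrFun h (c + 1)
    simp only [vertex, add_sub_cancel_right] at h1
    split_ifs at h1 with h2 h3 h3 <;> omega
  have hall : ∀ m : ℕ, τ (Fin.ofNat k m) < i ↔ τ 0 < i := by
    intro m
    induction m with
    | zero => simp
    | succ m ih =>
      have : Fin.ofNat k (m + 1) = Fin.ofNat k m + 1 := by
        apply Fin.ext
        simp [Fin.val_add]
      rw [this, hstep, ih]
  have hall' : ∀ c, τ c < i ↔ τ 0 < i := fun c => by simpa using hall c
  have h0 : τ (τ.symm 0) < i := by
    rw [apply_symm_apply]
    exact Fin.pos_iff_ne_zero.mpr hi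
  have h1 := (hall' (τ.symm i)).mpr ((hall' _).mp h0)
  simp at h1

/-- Exchanging two consecutive moves changes only the vertex between them. -/
lemma vertex_swap (w : Fin k → ℤ) (τ : Perm (Fin k)) {p i j : Fin k}
    (hp : (p : ℕ) + 1 = i) (hj : j ≠ i) :
    vertex w (swap p i * τ) j = vertex w τ j := by
  have key : ∀ a : Fin k, swap p i a < j ↔ a < j := by
    intro a
    have hj' : (j : ℕ) ≠ i := fun h => hj (Fin.ext h)
    rcases eq_or_ne a p with rfl | hap
    · rw [swap_apply_left, Fin.lt_def, Fin.lt_def]; omega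
    rcases eq_or_ne a i with rfl | hai
    · rw [swap_apply_right, Fin.lt_def, Fin.lt_def]; omega
    · rw [swap_apply_of_ne_of_ne hap hai]
  funext c
  simp only [vertex, Perm.mul_apply, key]

/-- All `k` moves together return to the start, so a cell may be based at any of its vertices by
shifting time cyclically. -/
lemma vertex_rotate (w : Fin k → ℤ) (τ : Perm (Fin k)) (i j : Fin k) :
    vertex (vertex w τ i) (τ.trans (Equiv.subRight i)) j = vertex w τ (i + j) := by
  -- The wrap-around term does not depend on `a`, so it cancels between `c - 1` and `c`.
  have key : ∀ a : Fin k, (if a < i then (1 : ℤ) else 0) + (if a - i < j then 1 else 0) =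
      (if a < i + j then 1 else 0) + (if (i : ℕ) + j < k then 0 else 1) := by
    intro a
    have ha := a.isLt
    have hi := i.isLt
    have hj := j.isLt
    have h1 : ((a - i : Fin k) : ℕ) = if (i : ℕ) ≤ a then (a : ℕ) - i else k + a - i := by
      rw [Fin.sub_def]
      split_ifs with h
      · show (k - i + a) % k = _
        rw [show k - (i : ℕ) + a = (a - i) + k by omega, Nat.add_mod_right,
          Nat.mod_eq_of_lt (by omega)]
      · show (k - i + a) % k = _
        rw [Nat.mod_eq_of_lt (by omega)]
        omega
    have h2 : ((i + j : Fin k) : ℕ) = if (i : ℕ) + j < k then (i : ℕ) + j else i + j - k := by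
      rw [Fin.val_add]
      split_ifs with h
      · exact Nat.mod_eq_of_lt h
      · rw [Nat.mod_eq_sub_mod (by omega), Nat.mod_eq_of_lt (by omega)]
    simp only [Fin.lt_def, h1, h2]
    split_ifs <;> omega
  funext c
  have e1 := key (τ (c - 1))
  have e2 := key (τ c)
  simp only [vertex, Equiv.trans_apply, Equiv.subRight_apply]
  linarith

/-! ### Parity of full cells under relabelling -/

/-- Replacing one value of a self-map of a finite type by `b`: the number of ways to obtain an
injective map is odd if and only if the map is injective. -/
lemma card_injective_update {I : Type*} [Fintype I] [DecidableEq I] (h : I → I) (b : I) :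
    (((univ.filter fun i => Function.Injective (Function.update h i b)).card : ℕ) : ZMod 2) =
      if Function.Injective h then 1 else 0 := by
  classical
  split_ifs with hh
  · obtain ⟨x, hx⟩ := (Finite.injective_iff_surjective.mp hh) b
    have : (univ.filter fun i => Function.Injective (Function.update h i b)) = {x} := by
      ext i
      simp only [mem_filter, mem_univ, true_and, mem_singleton]
      constructor
      · intro hi
        by_contra hne
        apply hne
        apply hi
        rw [Function.update_self, Function.update_of_ne (Ne.symm hne), hx]
      · rintro rfl
        rwa [← hx, Function.update_eq_self]
    rw [this]
    simp
  · obtain ⟨x, y, hxy, hne⟩ : ∃ x y, h x = h y ∧ x ≠ y := by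
      simpa [Function.Injective] using hh
    have hsub : ∀ i, Function.Injective (Function.update h i b) → i = x ∨ i = y := by
      intro i hi
      by_contra! hc
      apply hne
      apply hi
      rw [Function.update_of_ne hc.1.symm, Function.update_of_ne hc.2.symm, hxy]
    have hswap : Function.update h y b = Function.update h x b ∘ swap x y := by
      funext z
      rcases eq_or_ne z x with rfl | hzx
      · simp [hxy, hne, hne.symm]
      rcases eq_or_ne z y with rfl | hzy
      · simp
      · simp [swap_apply_of_ne_of_ne hzx hzy, hzx, hzy]
    have hiff : Function.Injective (Function.update h y b) ↔
        Function.Injective (Function.update h x b) := by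
      rw [hswap, Function.Injective.of_comp_iff' _ (swap x y).bijective]
    by_cases hx : Function.Injective (Function.update h x b)
    · have : (univ.filter fun i => Function.Injective (Function.update h i b)) = {x, y} := by
        ext i
        simp only [mem_filter, mem_univ, true_and, mem_insert, mem_singleton]
        constructor
        · exact hsub i
        · rintro (rfl | rfl)
          · exact hx
          · exact hiff.mpr hx
      rw [this, card_pair hne]
      rfl
    · have : (univ.filter fun i => Function.Injective (Function.update h i b)) = ∅ := by
        ext i
        simp only [mem_filter, mem_univ, true_and, notMem_empty, iff_false]
        intro hi
        rcases hsub i hi with rfl | rfl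
        · exact hx hi
        · exact hx (hiff.mp hi)
      rw [this]
      simp

/-- The parity of the number of fully labelled cells at `w` does not depend on the label of `w`. -/
lemma card_link_eq (L : (Fin k → ℤ) → Fin k) (w : Fin k → ℤ) (a b : Fin k) :
    (((univ.filter fun τ : Perm (Fin k) =>
      Function.Injective (Function.update (fun i => L (vertex w τ i)) 0 a)).card : ℕ) : ZMod 2) =
    ((univ.filter fun τ : Perm (Fin k) =>
      Function.Injective (Function.update (fun i => L (vertex w τ i)) 0 b)).card : ℕ) := by
  classical
  set h : Perm (Fin k) → Fin k → Fin k :=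
    fun τ => Function.update (fun i => L (vertex w τ i)) 0 a with hdef
  have hcount : ∀ τ, (if Function.Injective (h τ) then (1 : ZMod 2) else 0) =
      ∑ i, if Function.Injective (Function.update (h τ) i b) then (1 : ZMod 2) else 0 := by
    intro τ
    rw [← card_injective_update (h τ) b, Finset.natCast_card_filter]
  -- For `i ≠ 0`, exchanging moves `i - 1` and `i` alters only vertex `i`, whose label is
  -- overwritten by `b`; these terms cancel in pairs and only `i = 0` survives.
  have hoff : ∀ i ∈ univ.erase (0 : Fin k), ∑ τ : Perm (Fin k),
      (if Function.Injective (Function.update (h τ) i b) then (1 : ZMod 2) else 0) = 0 := by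
    intro i hi
    have hi0 : i ≠ 0 := ne_of_mem_erase hi
    have hipos : 0 < (i : ℕ) := Nat.pos_of_ne_zero fun h => hi0 (Fin.ext (by simpa using h))
    obtain ⟨p, hp⟩ : ∃ p : Fin k, (p : ℕ) + 1 = i :=
      ⟨⟨i - 1, by omega⟩, by simp; omega⟩
    have hpi : p ≠ i := by rintro rfl; omega
    have hinv : ∀ τ : Perm (Fin k),
        Function.update (h (swap p i * τ)) i b = Function.update (h τ) i b := by
      intro τ
      funext j
      rcases eq_or_ne j i with rfl | hj
      · simp
      · rw [Function.update_of_ne hj, Function.update_of_ne hj]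
        simp only [hdef, Function.update_apply, vertex_swap w τ hp hj]
    refine Finset.sum_involution (fun τ _ => swap p i * τ) ?_ ?_ ?_ ?_
    · intro τ _
      rw [hinv]
      exact CharTwo.add_self_eq_zero _
    · intro τ _ _ heq
      have : swap p i = 1 := mul_eq_right.mp heq
      exact hpi (swap_eq_one_iff.mp this)
    · intro τ _
      exact mem_univ _
    · intro τ _
      simp [← mul_assoc]
  rw [Finset.natCast_card_filter, Finset.natCast_card_filter]
  calc _ = ∑ τ : Perm (Fin k), ∑ i,
        (if Function.Injective (Function.update (h τ) i b) then (1 : ZMod 2) else 0) :=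
        Finset.sum_congr rfl fun τ _ => hcount τ
    _ = ∑ i, ∑ τ : Perm (Fin k),
        (if Function.Injective (Function.update (h τ) i b) then (1 : ZMod 2) else 0) :=
        Finset.sum_comm
    _ = ∑ τ : Perm (Fin k),
        (if Function.Injective (Function.update (h τ) 0 b) then (1 : ZMod 2) else 0) := by
        rw [← Finset.add_sum_erase _ _ (mem_univ (0 : Fin k)), Finset.sum_eq_zero hoff, add_zero]
    _ = _ := by simp only [hdef, Function.update_idem]

open Classical in
/-- The fully labelled cells with vertices in `V` whose base point has label `a`. -/
noncomputable def fullCells (V : Finset (Fin k → ℤ)) (L : (Fin k → ℤ) → Fin k) (a : Fin k) :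
    Finset ((Fin k → ℤ) × Perm (Fin k)) :=
  (V ×ˢ univ).filter fun q =>
    L q.1 = a ∧ (Function.Injective fun i => L (vertex q.1 q.2 i)) ∧ ∀ i, vertex q.1 q.2 i ∈ V

lemma mem_fullCells {V : Finset (Fin k → ℤ)} {L : (Fin k → ℤ) → Fin k} {a : Fin k}
    {q : (Fin k → ℤ) × Perm (Fin k)} :
    q ∈ fullCells V L a ↔ L q.1 = a ∧ (Function.Injective fun i => L (vertex q.1 q.2 i)) ∧
      ∀ i, vertex q.1 q.2 i ∈ V := by
  simp only [fullCells, mem_filter, mem_product, mem_univ, and_true, and_iff_right_iff_imp]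
  rintro ⟨-, -, h⟩
  simpa [vertex_zero] using h 0

/-- A full cell has exactly one vertex of each label: rebase it at the one labelled `b`. The vertex
labelled `a` recovers the original base. -/
lemma card_fullCells_le (V : Finset (Fin k → ℤ)) (L : (Fin k → ℤ) → Fin k) (a b : Fin k) :
    (fullCells V L a).card ≤ (fullCells V L b).card := by
  classical
  have hpos : ∀ q ∈ fullCells V L a, ∃ i, L (vertex q.1 q.2 i) = b := fun q hq =>
    Finite.injective_iff_surjective.mp (mem_fullCells.mp hq).2.1 b
  choose! pos hpos using hpos
  refine Finset.card_le_card_of_injOn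
    (fun q => (vertex q.1 q.2 (pos q), q.2.trans (Equiv.subRight (pos q)))) ?_ ?_
  · intro q hq
    have hq' := mem_fullCells.mp hq
    refine mem_coe.mpr (mem_fullCells.mpr ⟨hpos q hq, ?_, ?_⟩)
    · simp only [vertex_rotate]
      exact hq'.2.1.comp (add_right_injective _)
    · intro i
      simp only [vertex_rotate]
      exact hq'.2.2 _
  · rintro ⟨w, τ⟩ hq ⟨w', τ'⟩ hq' heq
    have h1 := mem_fullCells.mp hq
    have h2 := mem_fullCells.mp hq'
    simp only [Prod.mk.injEq] at heq
    obtain ⟨e1, e2⟩ := heq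
    have hv : ∀ j, vertex w τ (pos (w, τ) + j) = vertex w' τ' (pos (w', τ') + j) := by
      intro j
      rw [← vertex_rotate, ← vertex_rotate, e1, e2]
    have hp : pos (w, τ) = pos (w', τ') := by
      have h3 := hv (-pos (w, τ))
      rw [add_neg_cancel, vertex_zero] at h3
      have h4 : pos (w', τ') + -pos (w, τ) = 0 := by
        apply h2.2.1
        simp only
        rw [← h3, vertex_zero, h1.1, h2.1]
      exact (add_neg_eq_zero.mp h4).symm
    have hw : w = w' := by
      have h3 := hv (-pos (w, τ))
      rwa [add_neg_cancel, vertex_zero, hp, add_neg_cancel, vertex_zero] at h3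
    have hτ : τ = τ' := by
      rw [hp] at e2
      ext c : 1
      simpa using congrArg (fun f : Perm (Fin k) => f c) e2
    rw [hw, hτ]

lemma card_fullCells_eq (V : Finset (Fin k → ℤ)) (L : (Fin k → ℤ) → Fin k) (a b : Fin k) :
    (fullCells V L a).card = (fullCells V L b).card :=
  le_antisymm (card_fullCells_le V L a b) (card_fullCells_le V L b a)

/-- The lattice points of the simplex of size `N`. -/
noncomputable def lattice (k N : ℕ) : Finset (Fin k → ℤ) :=
  (Finset.Icc (0 : Fin k → ℤ) (fun _ => (N : ℤ))).filter fun x => ∑ c, x c = N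

omit [NeZero k] in
lemma mem_lattice {N : ℕ} {x : Fin k → ℤ} :
    x ∈ lattice k N ↔ (∀ c, 0 ≤ x c) ∧ ∑ c, x c = N := by
  simp only [lattice, mem_filter, mem_Icc, Pi.le_def, Pi.zero_apply]
  constructor
  · rintro ⟨⟨h1, -⟩, h2⟩
    exact ⟨h1, h2⟩
  · rintro ⟨h1, h2⟩
    refine ⟨⟨h1, fun c => ?_⟩, h2⟩
    rw [← h2]
    exact Finset.single_le_sum (fun i _ => h1 i) (mem_univ c)

/-- A labelling is admissible if each label names a positive coordinate. -/
def Admissible (N : ℕ) (L : (Fin k → ℤ) → Fin k) : Prop :=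
  ∀ x : Fin k → ℤ, ∑ c, x c = (N : ℤ) → 0 < x (L x)

/-- Each coordinate is the label of some vertex, where it is at least 1, and it varies by at most 1
over the cell. Hence full cells never leave the simplex, and no boundary analysis is needed. -/
lemma Admissible.vertex_mem {N : ℕ} {L : (Fin k → ℤ) → Fin k} (hL : Admissible N L)
    {w : Fin k → ℤ} (hw : ∑ c, w c = (N : ℤ)) {τ : Perm (Fin k)}
    (hinj : Function.Injective fun i => L (vertex w τ i)) (i : Fin k) :
    vertex w τ i ∈ lattice k N := by
  refine mem_lattice.mpr ⟨fun c => ?_, by rw [sum_vertex, hw]⟩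
  obtain ⟨j, hj⟩ := Finite.injective_iff_surjective.mp hinj c
  have h1 := hL (vertex w τ j) (by rw [sum_vertex, hw])
  simp only at hj
  rw [hj] at h1
  have h2 := vertex_le_add_one w τ j i c
  omega

/-- Labels in a full cell are distinct, so a cell with base label `L w` can contain `w` only as its
base. -/
lemma card_fullCells_eq_erase_add {N : ℕ} {L : (Fin k → ℤ) → Fin k} (hL : Admissible N L)
    {w : Fin k → ℤ} (hw : w ∈ lattice k N) :
    (fullCells (lattice k N) L (L w)).card = (fullCells ((lattice k N).erase w) L (L w)).card +
      (univ.filter fun τ : Perm (Fin k) =>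
        Function.Injective fun i => L (vertex w τ i)).card := by
  classical
  rw [← Finset.card_filter_add_card_filter_not (s := fullCells (lattice k N) L (L w))
    (fun q => q.1 ≠ w)]
  congr 1
  · congr 1
    ext ⟨u, τ⟩
    simp only [mem_filter, mem_fullCells, mem_erase]
    constructor
    · rintro ⟨⟨h1, h2, h3⟩, h4⟩
      refine ⟨h1, h2, fun i => ⟨fun hi => h4 ?_, h3 i⟩⟩
      have : i = 0 := by
        apply h2
        simp only
        rw [hi, vertex_zero, h1]
      rw [← hi, this, vertex_zero]
    · rintro ⟨h1, h2, h3⟩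
      refine ⟨⟨h1, h2, fun i => (h3 i).2⟩, ?_⟩
      simpa [vertex_zero] using (h3 0).1
  · refine Finset.card_bij' (fun q _ => q.2) (fun τ _ => (w, τ)) ?_ ?_ ?_ ?_
    · rintro ⟨u, τ⟩ h
      simp only [mem_filter, mem_fullCells, not_not] at h
      obtain ⟨⟨-, h2, -⟩, rfl⟩ := h
      simpa using h2
    · intro τ h
      simp only [mem_filter, mem_univ, true_and] at h
      simp only [mem_filter, mem_fullCells, not_not, and_true, true_and]
      exact ⟨h, hL.vertex_mem (mem_lattice.mp hw).2 h⟩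
    · rintro ⟨u, τ⟩ h
      simp only [mem_filter, not_not] at h
      rw [h.2]
    · intro τ _
      rfl

/-- Changing the label of one lattice point preserves the parity of the number of full cells. -/
lemma card_fullCells_update {N : ℕ} {L : (Fin k → ℤ) → Fin k} (hL : Admissible N L)
    {w : Fin k → ℤ} (hw : w ∈ lattice k N) (b c : Fin k)
    (hL' : Admissible N (Function.update L w b)) :
    (((fullCells (lattice k N) L c).card : ℕ) : ZMod 2) =
      (fullCells (lattice k N) (Function.update L w b) c).card := by
  classical
  set L' := Function.update L w b with hdef
  have hb : L' w = b := by simp [hdef]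
  have hoff : ∀ x, x ≠ w → L' x = L x := fun x hx => by simp [hdef, hx]
  -- Base labels `L w` and `L' w` separate off the cells at `w`; returning to the common base label
  -- `c` makes the cells avoiding `w` comparable.
  rw [card_fullCells_eq _ L c (L w), card_fullCells_eq _ L' c (L' w),
    card_fullCells_eq_erase_add hL hw, card_fullCells_eq_erase_add hL' hw,
    card_fullCells_eq _ L (L w) c, card_fullCells_eq _ L' (L' w) c]
  have h1 : fullCells ((lattice k N).erase w) L c = fullCells ((lattice k N).erase w) L' c := by
    ext ⟨u, τ⟩
    simp only [mem_fullCells]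
    have aux : (∀ i, vertex u τ i ∈ (lattice k N).erase w) →
        (L' u = L u ∧ (fun i => L' (vertex u τ i)) = fun i => L (vertex u τ i)) := by
      intro h
      have h' : ∀ i, L' (vertex u τ i) = L (vertex u τ i) := fun i =>
        hoff _ (ne_of_mem_erase (h i))
      exact ⟨by simpa [vertex_zero] using h' 0, funext h'⟩
    constructor
    · rintro ⟨h1, h2, h3⟩
      rw [(aux h3).1, (aux h3).2]
      exact ⟨h1, h2, h3⟩
    · rintro ⟨h1, h2, h3⟩
      rw [(aux h3).1, (aux h3).2] at *
      exact ⟨h1, h2, h3⟩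
  have h2 : ∀ τ : Perm (Fin k), (fun i => L (vertex w τ i)) =
      Function.update (fun i => L (vertex w τ i)) 0 (L w) := by
    intro τ
    funext i
    rcases eq_or_ne i 0 with rfl | hi
    · simp [vertex_zero]
    · simp [hi]
  have h3 : ∀ τ : Perm (Fin k), (Function.Injective fun i => L' (vertex w τ i)) ↔
      Function.Injective (Function.update (fun i => L (vertex w τ i)) 0 b) := by
    intro τ
    have : (fun i => L' (vertex w τ i)) =
        Function.update (fun i => L (vertex w τ i)) 0 b := by
      funext i
      rcases eq_or_ne i 0 with rfl | hi
      · simp [vertex_zero, hb]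
      · simp [hi, hoff _ (vertex_ne w τ hi)]
    rw [this]
  have h4 := card_link_eq L w (L w) b
  simp only [← h2] at h4
  rw [h1]
  push_cast
  rw [h4]
  simp only [h3]

/-! ### A labelling with one full cell, and Sperner's lemma -/

/-- The label of `x` is its first positive coordinate. -/
noncomputable def firstPos (x : Fin k → ℤ) : Fin k :=
  open Classical in if h : ∃ c, 0 < x c then (Finset.univ.filter fun c => 0 < x c).min'
    (by obtain ⟨c, hc⟩ := h; exact ⟨c, by simpa using hc⟩) else 0

lemma firstPos_eq {x : Fin k → ℤ} {c : Fin k} (hc : 0 < x c) (hlt : ∀ d < c, x d ≤ 0) :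
    firstPos x = c := by
  classical
  have h : ∃ c, 0 < x c := ⟨c, hc⟩
  rw [firstPos, dif_pos h]
  refine le_antisymm (Finset.min'_le _ _ (by simpa using hc)) (Finset.le_min' _ _ _ ?_)
  intro d hd
  by_contra! hdc
  have := hlt d hdc
  simp at hd
  omega

lemma firstPos_spec {x : Fin k → ℤ} (h : ∃ c, 0 < x c) :
    0 < x (firstPos x) ∧ ∀ d < firstPos x, x d ≤ 0 := by
  classical
  obtain ⟨c, hc, hmin⟩ : ∃ c, 0 < x c ∧ ∀ d < c, x d ≤ 0 := by
    obtain ⟨c, hc⟩ := (Set.toFinite {c | 0 < x c}).exists_minimal h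
    refine ⟨c, hc.1, fun d hd => ?_⟩
    by_contra! hd'
    exact absurd (hc.2 hd' hd.le) (not_le.mpr hd)
  rw [firstPos_eq hc hmin]
  exact ⟨hc, hmin⟩

omit [NeZero k] in
lemma exists_pos_of_sum_eq {N : ℕ} (hN : 0 < N) {x : Fin k → ℤ} (hx : ∑ c, x c = (N : ℤ)) :
    ∃ c, 0 < x c := by
  by_contra! h
  have := Finset.sum_nonpos (s := univ) fun c _ => h c
  omega

lemma admissible_firstPos {N : ℕ} (hN : 0 < N) : Admissible (k := k) N firstPos :=
  fun _ hx => (firstPos_spec (exists_pos_of_sum_eq hN hx)).1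

/-- The only full cell of `firstPos` with base label `k - 1`. -/
lemma card_fullCells_firstPos {N : ℕ} (hN : 0 < N) {l : Fin k} (hl : (l : ℕ) + 1 = k) :
    (fullCells (lattice k N) firstPos l).card = 1 := by
  classical
  have hle : ∀ c : Fin k, c ≤ l := fun c => by rw [Fin.le_def]; omega
  have hl1 : l + 1 = 0 := by
    apply Fin.ext
    rw [Fin.val_add]
    rcases Nat.lt_or_ge 1 k with h | h
    · rw [Fin.val_one', Nat.mod_eq_of_lt h, hl]; simp
    · have : k = 1 := by have := l.isLt; omega
      subst this; exact Nat.mod_one _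
  have hsucc : ∀ c : Fin k, c ≠ l → ((c + 1 : Fin k) : ℕ) = c + 1 := by
    intro c hc
    have h1 : (c : ℕ) ≠ l := fun h => hc (Fin.ext h)
    have h2 := c.isLt
    rw [Fin.val_add, Fin.val_one', Nat.mod_eq_of_lt (a := 1) (by omega),
      Nat.mod_eq_of_lt (by omega)]
  have hval : ∀ i c : Fin k,
      vertex (Pi.single l (N : ℤ)) (Equiv.addRight 1) i c =
      (if c = l then (N : ℤ) - (if i = 0 then 0 else 1) else if (c : ℕ) + 1 = i then 1 else 0) := by
    intro i c
    simp only [vertex, Equiv.coe_addRight, sub_add_cancel]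
    rcases eq_or_ne c l with rfl | hc
    · simp only [hl1, not_lt.mpr (hle i), Pi.single_eq_same, if_true, if_false, add_zero,
        Fin.pos_iff_ne_zero, ne_eq, ite_not]
    · simp only [hc, Pi.single_eq_of_ne hc, Fin.lt_def, hsucc c hc, if_false]
      split_ifs <;> omega
  refine Finset.card_eq_one.mpr ⟨(Pi.single l (N : ℤ), Equiv.addRight 1), ?_⟩
  ext ⟨w, τ⟩
  simp only [mem_fullCells, mem_singleton, Prod.mk.injEq]
  constructor
  · rintro ⟨h1, h2, h3⟩
    have hw := mem_lattice.mp (by simpa [vertex_zero] using h3 0)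
    have hw0 : ∀ c, c ≠ l → w c = 0 := by
      intro c hc
      have := (firstPos_spec (exists_pos_of_sum_eq hN hw.2)).2 c (by
        rw [h1]; exact lt_of_le_of_ne (hle c) hc)
      exact le_antisymm this (hw.1 c)
    refine ⟨?_, ?_⟩
    · funext c
      rcases eq_or_ne c l with rfl | hc
      · rw [Pi.single_eq_same, ← hw.2, Finset.sum_eq_single c]
        · intro d _ hd
          exact hw0 d hd
        · simp
      · rw [hw0 c hc, Pi.single_eq_of_ne hc]
    -- Coordinate `c` starts at 0, so a unit must arrive there before one leaves; this forces the
    -- order of all moves.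
    · have hmono : ∀ c, c ≠ l → τ (c - 1) ≤ τ c := by
        intro c hc
        by_contra! hlt
        have := (mem_lattice.mp (h3 (τ (c - 1)))).1 c
        simp only [vertex, hw0 c hc, hlt, lt_irrefl, if_true, if_false] at this
        omega
      have hval : ∀ m : ℕ, ∀ hm : m < k, m ≤ τ (⟨m, hm⟩ - 1) := by
        intro m
        induction m with
        | zero => intro _; exact Nat.zero_le _
        | succ m ih =>
          intro hm
          have hne : (⟨m, by omega⟩ : Fin k) ≠ l := by
            intro h
            have := congrArg Fin.val h
            simp at this
            omega
          have h4 : (⟨m + 1, hm⟩ : Fin k) - 1 = ⟨m, by omega⟩ := by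
            rw [sub_eq_iff_eq_add]
            apply Fin.ext
            rw [hsucc _ hne]
          rw [h4]
          have h5 := ih (by omega)
          have h6 := hmono _ hne
          have h7 : τ (⟨m, by omega⟩ - 1) ≠ τ (⟨m, by omega⟩ : Fin k) := by
            intro h
            have h8 := τ.injective h
            rw [sub_eq_iff_eq_add] at h8
            have h9 := congrArg Fin.val h8
            rw [hsucc _ hne] at h9
            simp at h9
          have h10 := lt_of_le_of_ne h6 h7
          rw [Fin.lt_def] at h10
          omega
      have hid : ∀ c : Fin k,
          (c : ℕ) ≤ ((Equiv.subRight (1 : Fin k)).trans τ c : Fin k) := by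
        intro c
        exact hval c c.isLt
      have hid' : (Equiv.subRight (1 : Fin k)).trans τ = 1 := by
        have hsum : ∑ c : Fin k, (c : ℕ) =
            ∑ c, (((Equiv.subRight (1 : Fin k)).trans τ c : Fin k) : ℕ) :=
          (Equiv.sum_comp ((Equiv.subRight (1 : Fin k)).trans τ) fun c => (c : ℕ)).symm
        ext c : 2
        exact ((Finset.sum_eq_sum_iff_of_le fun c _ => hid c).mp hsum c (mem_univ c)).symm
      ext c : 1
      have := congrArg (fun f : Perm (Fin k) => f (c + 1)) hid'
      simpa using this
  · rintro ⟨rfl, rfl⟩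
    have hlab : ∀ i : Fin k, firstPos (vertex (Pi.single l (N : ℤ)) (Equiv.addRight 1) i) =
        i - 1 := by
      intro i
      rcases eq_or_ne i 0 with rfl | hi
      · have : (0 : Fin k) - 1 = l := by rw [sub_eq_iff_eq_add, hl1]
        rw [this, vertex_zero]
        refine firstPos_eq (by simpa using hN) fun d hd => ?_
        rw [Pi.single_eq_of_ne hd.ne]
      · have hipos : 0 < (i : ℕ) := Nat.pos_of_ne_zero fun h => hi (Fin.ext (by simpa using h))
        have h1 : (i - 1 : Fin k) ≠ l := by
          intro h
          rw [sub_eq_iff_eq_add, hl1] at h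
          exact hi h
        have h2 := hsucc _ h1
        rw [sub_add_cancel] at h2
        refine firstPos_eq ?_ fun d hd => ?_
        · rw [hval, if_neg h1, if_pos h2.symm]
          exact one_pos
        · rw [hval, if_neg (lt_of_lt_of_le hd (hle _)).ne, if_neg]
          rw [Fin.lt_def] at hd
          omega
    have hinj : Function.Injective fun i : Fin k =>
        firstPos (vertex (Pi.single l (N : ℤ)) (Equiv.addRight 1) i) := by
      simp only [hlab]
      exact (Equiv.subRight (1 : Fin k)).injective
    refine ⟨?_, hinj, (admissible_firstPos hN).vertex_mem ?_ hinj⟩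
    · have := hlab 0
      rw [vertex_zero] at this
      rw [this, sub_eq_iff_eq_add, hl1]
    · simp

/-- **Sperner's lemma** for the cyclic Freudenthal triangulation of the simplex of size `N`. -/
theorem exists_full_cell {N : ℕ} (hN : 0 < N) (L : (Fin k → ℤ) → Fin k)
    (hL : ∀ x ∈ lattice k N, 0 < x (L x)) :
    ∃ w τ, (∀ i, vertex w τ i ∈ lattice k N) ∧
      Function.Injective fun i => L (vertex w τ i) := by
  classical
  obtain ⟨l, hl⟩ : ∃ l : Fin k, (l : ℕ) + 1 = k :=
    ⟨⟨k - 1, Nat.sub_lt (NeZero.pos k) one_pos⟩, Nat.succ_pred_eq_of_pos (NeZero.pos k)⟩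
  -- Keeping `firstPos` off `S` gives admissibility on the whole hyperplane, though `L` is
  -- controlled only on the simplex.
  have hadm : ∀ S : Finset (Fin k → ℤ), S ⊆ lattice k N →
      Admissible N (S.piecewise L firstPos) := by
    intro S hS x hx
    by_cases hxS : x ∈ S
    · rw [Finset.piecewise_eq_of_mem _ _ _ hxS]
      exact hL x (hS hxS)
    · rw [Finset.piecewise_eq_of_notMem _ _ _ hxS]
      exact admissible_firstPos hN x hx
  have hind : ∀ S : Finset (Fin k → ℤ), S ⊆ lattice k N →
      (((fullCells (lattice k N) (S.piecewise L firstPos) l).card : ℕ) : ZMod 2) = 1 := by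
    intro S
    induction S using Finset.induction_on with
    | empty =>
      intro _
      rw [Finset.piecewise_empty, card_fullCells_firstPos hN hl, Nat.cast_one]
    | insert x S hx ih =>
      intro hS
      have h1 := (Finset.insert_subset_iff.mp hS)
      have h2 := hadm _ hS
      rw [Finset.piecewise_insert] at h2 ⊢
      rw [← card_fullCells_update (hadm S h1.2) h1.1 (L x) l h2]
      exact ih h1.2
  have hne : (fullCells (lattice k N) ((lattice k N).piecewise L firstPos) l).Nonempty := by
    rw [Finset.nonempty_iff_ne_empty]
    intro h0
    have := hind _ (Finset.Subset.refl _)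
    rw [h0] at this
    simp at this
  obtain ⟨⟨w, τ⟩, hq⟩ := hne
  obtain ⟨-, h2, h3⟩ := mem_fullCells.mp hq
  refine ⟨w, τ, h3, ?_⟩
  simpa only [Finset.piecewise_eq_of_mem _ _ _ (h3 _)] using h2

end Sperner

open Filter Topology

/-! ### The KKM lemma on the space of partitions -/

section KKM

lemma isClosed_partitions (k : ℕ) : IsClosed (partitions k) := by
  have h : partitions k = {c | Monotone c} ∩ ({c | c 0 = 0} ∩ {c | c (Fin.last k) = 1}) := rfl
  rw [h]
  exact isClosed_monotone.inter
    ((isClosed_eq (continuous_apply _) continuous_const).inter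
      (isClosed_eq (continuous_apply _) continuous_const))

instance compactSpace_partition (k : ℕ) : CompactSpace (Partition k) := by
  refine isCompact_iff_compactSpace.mp ((isCompact_Icc (a := (0 : Fin (k + 1) → ℝ))
    (b := 1)).of_isClosed_subset (isClosed_partitions k) ?_)
  rintro c ⟨hm, h0, h1⟩
  refine ⟨fun i => ?_, fun i => ?_⟩
  · simpa [h0] using hm (Fin.zero_le i)
  · simpa [h1] using hm (Fin.le_last i)

variable {k : ℕ}

lemma Partition.continuous_length (j : Fin k) : Continuous fun P : Partition k => P.length j :=
  ((continuous_apply j.succ).comp continuous_subtype_val).sub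
    ((continuous_apply j.castSucc).comp continuous_subtype_val)

/-- The cut points of the partition whose `j`-th piece has length `x j / N`. -/
noncomputable def cuts (N : ℕ) (x : Fin k → ℤ) (i : Fin (k + 1)) : ℝ :=
  (∑ j : Fin k, if j.castSucc < i then (x j : ℝ) else 0) / N

lemma cuts_succ_sub (N : ℕ) (x : Fin k → ℤ) (j : Fin k) :
    cuts N x j.succ - cuts N x j.castSucc = x j / N := by
  rw [cuts, cuts, ← sub_div, ← Finset.sum_sub_distrib]
  congr 1
  rw [Finset.sum_eq_single j]
  · simp
  · intro l _ hl
    have hl' : (l : ℕ) ≠ j := fun h => hl (Fin.ext h)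
    simp only [Fin.lt_def, Fin.val_castSucc, Fin.val_succ]
    split_ifs <;> first | omega | simp
  · simp

lemma cuts_mem {N : ℕ} (hN : 0 < N) {x : Fin k → ℤ} (hx : x ∈ lattice k N) :
    cuts N x ∈ partitions k := by
  rw [mem_lattice] at hx
  refine ⟨Fin.monotone_iff_le_succ.mpr fun j => ?_, by simp [cuts], ?_⟩
  · rw [← sub_nonneg, cuts_succ_sub]
    have := hx.1 j
    positivity
  · have : (∑ j : Fin k, (x j : ℝ)) = N := by exact_mod_cast hx.2
    simp [cuts, Fin.castSucc_lt_last, this, hN.ne']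

lemma abs_cuts_sub_le (N : ℕ) {x y : Fin k → ℤ} (h : ∀ j, |x j - y j| ≤ 1) (i : Fin (k + 1)) :
    |cuts N x i - cuts N y i| ≤ k / N := by
  rw [cuts, cuts, ← sub_div, ← Finset.sum_sub_distrib, abs_div, Nat.abs_cast]
  gcongr
  calc _ ≤ ∑ j : Fin k, |(if j.castSucc < i then (x j : ℝ) else 0) -
        (if j.castSucc < i then (y j : ℝ) else 0)| := Finset.abs_sum_le_sum_abs _ _
    _ ≤ ∑ _j : Fin k, (1 : ℝ) := by
        refine Finset.sum_le_sum fun j _ => ?_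
        split_ifs
        · exact_mod_cast h j
        · simp
    _ = k := by simp

/-- The **Knaster–Kuratowski–Mazurkiewicz lemma** on the space of partitions. -/
theorem exists_mem_all_of_closed_cover (hk : 0 < k) (F : Fin k → Set (Partition k))
    (hF : ∀ j, IsClosed (F j)) (hcov : ∀ P : Partition k, ∃ j, 0 < P.length j ∧ P ∈ F j) :
    ∃ P, ∀ j, P ∈ F j := by
  classical
  have : NeZero k := ⟨hk.ne'⟩
  choose lab hpos hlab using hcov
  have hstep : ∀ N : ℕ, ∃ p : Fin k → Partition k, (∀ j, p j ∈ F j) ∧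
      ∀ i j, dist (p i) (p j) ≤ k / ((N : ℝ) + 1) := by
    intro N
    -- The default label 0 is harmless: Sperner's lemma tests only lattice points. Mesh `N + 1`
    -- avoids division by zero.
    let L : (Fin k → ℤ) → Fin k := fun x =>
      if h : x ∈ lattice k (N + 1) then lab ⟨_, cuts_mem N.succ_pos h⟩ else 0
    obtain ⟨w, τ, hmem, hinj⟩ := exists_full_cell N.succ_pos L (by
      intro x hx
      have h1 := hpos ⟨_, cuts_mem N.succ_pos hx⟩
      rw [Partition.length, cuts_succ_sub] at h1
      have h2 : (0 : ℝ) < ((N + 1 : ℕ) : ℝ) := by positivity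
      have h3 := (div_pos_iff_of_pos_right h2).mp h1
      simp only [L, dif_pos hx]
      exact_mod_cast h3)
    choose v hv using Finite.injective_iff_surjective.mp hinj
    refine ⟨fun j => ⟨_, cuts_mem N.succ_pos (hmem (v j))⟩, fun j => ?_, fun i j => ?_⟩
    · have h1 := hv j
      simp only [L, dif_pos (hmem (v j))] at h1
      have h2 := hlab ⟨_, cuts_mem N.succ_pos (hmem (v j))⟩
      rwa [h1] at h2
    · rw [Subtype.dist_eq, dist_pi_le_iff (by positivity)]
      intro c
      rw [Real.dist_eq]
      refine (abs_cuts_sub_le (N + 1) (fun l => ?_) c).trans (by push_cast; rfl)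
      have h1 := vertex_le_add_one w τ (v i) (v j) l
      have h2 := vertex_le_add_one w τ (v j) (v i) l
      rw [abs_le]
      constructor <;> omega
  choose p hp hdist using hstep
  obtain ⟨P, φ, hφ, hlim⟩ := CompactSpace.tendsto_subseq fun N => p N 0
  refine ⟨P, fun j => ?_⟩
  have hzero : Tendsto (fun N : ℕ => (k : ℝ) / ((N : ℝ) + 1)) atTop (𝓝 0) :=
    tendsto_const_nhds.div_atTop (tendsto_natCast_atTop_atTop.atTop_add tendsto_const_nhds)
  have hd : Tendsto (fun N => dist (p (φ N) 0) (p (φ N) j)) atTop (𝓝 0) :=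
    squeeze_zero (fun _ => dist_nonneg) (fun N => hdist (φ N) 0 j) (hzero.comp hφ.tendsto_atTop)
  exact (hF j).mem_of_tendsto ((tendsto_iff_of_dist hd).mp hlim)
    (Eventually.of_forall fun N => hp (φ N) j)

end KKM

/-! ### From hungry guests to a strict Hall condition -/

section Hungry

variable {n k : ℕ}

/-- Fractional assignments of pieces to guests, of total mass at least `k + 1` and at most `1` for
each guest, that use only nonempty pieces and almost-preferred partitions. -/
def fractionalAssignments (A : Preferences n k) (ε : ℝ) (P : Partition k) :
    Set (Fin n → Fin k → ℝ) :=
  {m | (∀ i j, 0 ≤ m i j) ∧ (∀ i, ∑ j, m i j ≤ 1) ∧ (k + 1 : ℝ) ≤ ∑ i, ∑ j, m i j ∧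
    ∀ i j, m i j ≠ 0 → 0 < P.length j ∧ ∃ Q ∈ A i j, dist P Q < ε}

lemma convex_fractionalAssignments (A : Preferences n k) (ε : ℝ) (P : Partition k) :
    Convex ℝ (fractionalAssignments A ε P) := by
  rintro m ⟨h1, h2, h3, h4⟩ m' ⟨h1', h2', h3', h4'⟩ a b ha hb hab
  have hs : ∀ i, ∑ j, (a • m + b • m') i j = a * ∑ j, m i j + b * ∑ j, m' i j := by
    intro i
    simp [Finset.sum_add_distrib, Finset.mul_sum]
  refine ⟨fun i j => ?_, fun i => ?_, ?_, fun i j hne => ?_⟩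
  · have := h1 i j
    have := h1' i j
    simp only [Pi.add_apply, Pi.smul_apply, smul_eq_mul]
    positivity
  · rw [hs]
    nlinarith [h2 i, h2' i]
  · simp only [hs, Finset.sum_add_distrib, ← Finset.mul_sum]
    nlinarith
  · by_cases hm : m i j = 0
    · refine h4' i j fun hm' => hne ?_
      simp [hm, hm']
    · exact h4 i j hm

lemma IsHungry.card_hungry {A : Preferences n k} (hkn : k < n) (hA : IsHungry (k + 1) A)
    (P : Partition k) [DecidablePred fun i => ∃ j, 0 < P.length j ∧ P ∈ A i j] :
    k + 1 ≤ (univ.filter fun i => ∃ j, 0 < P.length j ∧ P ∈ A i j).card := by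
  by_contra! hlt
  have h1 := Finset.card_filter_add_card_filter_not (s := (univ : Finset (Fin n)))
    (fun i => ∃ j, 0 < P.length j ∧ P ∈ A i j)
  rw [Finset.card_univ, Fintype.card_fin] at h1
  obtain ⟨C, hC, hcard⟩ := Finset.exists_subset_card_eq
    (s := univ.filter fun i => ¬∃ j, 0 < P.length j ∧ P ∈ A i j) (n := n - k) (by omega)
  obtain ⟨i, hi, hj⟩ := hA.1 P C (by omega)
  exact (mem_filter.mp (hC hi)).2 hj

/-- Positivity of lengths is an open condition, and `P` itself witnesses almost-preference for all
`Q` within `ε`. This local constancy is the reason for enlarging the preferences. -/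
lemma IsHungry.exists_local_assignment {A : Preferences n k} (hkn : k < n)
    (hA : IsHungry (k + 1) A) {ε : ℝ} (hε : 0 < ε) (P : Partition k) :
    ∃ m, ∀ᶠ Q in 𝓝 P, m ∈ fractionalAssignments A ε Q := by
  classical
  set H := univ.filter fun i => ∃ j, 0 < P.length j ∧ P ∈ A i j with hH
  have hfav : ∀ i ∈ H, ∃ j, 0 < P.length j ∧ P ∈ A i j := fun i hi => (mem_filter.mp hi).2
  choose fav hlen hmem using hfav
  set m : Fin n → Fin k → ℝ :=
    fun i j => if h : i ∈ H then (if fav i h = j then 1 else 0) else 0 with hm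
  have hrow : ∀ i, ∑ j, m i j = if i ∈ H then 1 else 0 := by
    intro i
    by_cases h : i ∈ H <;> simp [hm, h]
  have hev : ∀ i j, m i j ≠ 0 →
      ∀ᶠ Q in 𝓝 P, 0 < Partition.length Q j ∧ ∃ R ∈ A i j, dist Q R < ε := by
    intro i j hne
    have h : i ∈ H := by
      by_contra h
      exact hne (by simp [hm, h])
    have hj : fav i h = j := by
      by_contra hj
      exact hne (by simp [hm, h, hj])
    subst hj
    filter_upwards [(Partition.continuous_length _).continuousAt.eventually_const_lt (hlen i h),
      Metric.ball_mem_nhds P hε] with Q h1 h2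
    exact ⟨h1, P, hmem i h, h2⟩
  refine ⟨m, ?_⟩
  have hev' : ∀ᶠ Q in 𝓝 P, ∀ i j, m i j ≠ 0 →
      0 < Partition.length Q j ∧ ∃ R ∈ A i j, dist Q R < ε := by
    simp only [eventually_all]
    exact hev
  filter_upwards [hev'] with Q hQ
  refine ⟨fun i j => ?_, fun i => ?_, ?_, hQ⟩
  · simp only [hm]
    split_ifs <;> norm_num
  · rw [hrow]
    split_ifs <;> norm_num
  · simp only [hrow]
    rw [Finset.sum_boole, Finset.filter_mem_eq_inter, Finset.univ_inter]
    exact_mod_cast hA.card_hungry hkn P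

/-- For every `ε > 0`, some partition satisfies the strict Hall condition for the preferences
enlarged by `ε`. -/
lemma IsHungry.exists_approximate {A : Preferences n k} (hk : 0 < k) (hkn : k < n)
    (hA : IsHungry (k + 1) A) {ε : ℝ} (hε : 0 < ε) :
    ∃ P : Partition k, ∀ J : Finset (Fin k), J.Nonempty → ∀ T : Finset (Fin n),
      (∀ i j, j ∈ J → (∃ Q ∈ A i j, dist P Q < ε) → i ∈ T) → J.card < T.card := by
  classical
  obtain ⟨g, hg⟩ := exists_continuous_forall_mem_convex_of_local_const
    (convex_fractionalAssignments A ε) (hA.exists_local_assignment hkn hε)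
  have hgc : ∀ i j, Continuous fun P => g P i j := fun i j =>
    (continuous_apply j).comp ((continuous_apply i).comp g.continuous)
  have hk' : (0 : ℝ) < k := by exact_mod_cast hk
  obtain ⟨P, hP⟩ := exists_mem_all_of_closed_cover hk
    -- The threshold is the average of mass `k + 1` over `k` pieces; exceeding 1 is what makes
    -- Hall's inequality strict.
    (fun j => {P | ((k : ℝ) + 1) / k ≤ ∑ i, g P i j})
    (fun j => isClosed_le continuous_const (continuous_finsetSum _ fun i _ => hgc i j)) (by
      intro P
      obtain ⟨h1, h2, h3, h4⟩ := hg P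
      by_contra! hc
      rw [Finset.sum_comm] at h3
      have hle : ∀ j ∈ (univ : Finset (Fin k)), ∑ i, g P i j < ((k : ℝ) + 1) / k := by
        intro j _
        by_cases hj : 0 < P.length j
        · simpa using hc j hj
        · rw [Finset.sum_eq_zero]
          · positivity
          · intro i _
            by_contra hne
            exact hj (h4 i j hne).1
      have h5 := Finset.sum_lt_sum_of_nonempty ⟨⟨0, hk⟩, mem_univ _⟩ hle
      rw [Finset.sum_const, Finset.card_univ, Fintype.card_fin, nsmul_eq_mul,
        mul_div_cancel₀ _ hk'.ne'] at h5
      linarith)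
  refine ⟨P, fun J hJ T hT => ?_⟩
  obtain ⟨h1, h2, -, h4⟩ := hg P
  have hlow : (J.card : ℝ) * (((k : ℝ) + 1) / k) ≤ ∑ j ∈ J, ∑ i, g P i j := by
    rw [← nsmul_eq_mul]
    exact Finset.card_nsmul_le_sum _ _ _ fun j _ => hP j
  have hcol : ∀ j ∈ J, ∑ i, g P i j = ∑ i ∈ T, g P i j := by
    intro j hj
    refine (Finset.sum_subset (subset_univ T) fun i _ hi => ?_).symm
    by_contra hne
    exact hi (hT i j hj (h4 i j hne).2)
  have hup : ∑ j ∈ J, ∑ i, g P i j ≤ T.card := by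
    rw [Finset.sum_congr rfl hcol, Finset.sum_comm]
    calc _ ≤ ∑ i ∈ T, (1 : ℝ) := Finset.sum_le_sum fun i _ =>
          (Finset.sum_le_sum_of_subset_of_nonneg (subset_univ J) fun j _ _ => h1 i j).trans (h2 i)
      _ = T.card := by simp
  have hJ' : (0 : ℝ) < J.card := by exact_mod_cast hJ.card_pos
  have hgt : (1 : ℝ) < ((k : ℝ) + 1) / k := by
    rw [one_lt_div hk']
    linarith
  have : (J.card : ℝ) < T.card := by nlinarith
  exact_mod_cast this

/-- Some partition satisfies the strict Hall condition. -/
lemma IsHungry.exists_strict_hall {A : Preferences n k} (hk : 0 < k) (hkn : k < n)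
    (hA : IsHungry (k + 1) A) :
    ∃ P : Partition k, ∀ J : Finset (Fin k), J.Nonempty → ∀ T : Finset (Fin n),
      (∀ i j, j ∈ J → P ∈ A i j → i ∈ T) → J.card < T.card := by
  have hε : ∀ N : ℕ, (0 : ℝ) < 1 / ((N : ℝ) + 1) := fun N => by positivity
  choose p hp using fun N : ℕ => hA.exists_approximate hk hkn (hε N)
  obtain ⟨P, φ, hφ, hlim⟩ := CompactSpace.tendsto_subseq p
  have hzero : Tendsto (fun N => 1 / ((φ N : ℝ) + 1)) atTop (𝓝 0) :=
    tendsto_one_div_add_atTop_nhds_zero_nat.comp hφ.tendsto_atTop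
  have hev : ∀ i j, P ∉ A i j →
      ∀ᶠ N in atTop, ¬∃ Q ∈ A i j, dist (p (φ N)) Q < 1 / ((φ N : ℝ) + 1) := by
    intro i j hPA
    obtain ⟨δ, hδ, hball⟩ := Metric.isOpen_iff.mp (hA.2 i j).isOpen_compl P hPA
    filter_upwards [hzero.eventually_lt_const (half_pos hδ),
      hlim.eventually (Metric.ball_mem_nhds P (half_pos hδ))] with N h1 h2
    rintro ⟨Q, hQ, hd⟩
    rw [Function.comp_apply] at h2
    have hQP : Q ∈ Metric.ball P δ := by
      rw [Metric.mem_ball]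
      have := dist_triangle_left Q P (p (φ N))
      linarith
    exact hball hQP hQ
  have hev' : ∀ᶠ N in atTop, ∀ i j, P ∉ A i j →
      ¬∃ Q ∈ A i j, dist (p (φ N)) Q < 1 / ((φ N : ℝ) + 1) := by
    simp only [eventually_all]
    exact hev
  obtain ⟨N, hN⟩ := hev'.exists
  -- For this single `N`, every enlarged preference at `p (φ N)` is a true preference at `P`, so any
  -- `T` admissible at `P` is admissible there.
  refine ⟨P, fun J hJ T hT => hp (φ N) J hJ T fun i j hj hQ => hT i j hj ?_⟩
  by_contra hPA
  exact hN i j hPA hQ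

end Hungry

end CakeCutting

theorem corollary1p5 (n k : ℕ) (hk : 0 < k) (hkn : k < n)
    (A : CakeCutting.Preferences n k) (hA : CakeCutting.IsHungry (k + 1) A) :
    ∃ P : CakeCutting.Partition k, ∀ e : Fin n, CakeCutting.EnvyFreeAmong A P {e}ᶜ := by
  classical
  obtain ⟨P, hP⟩ := hA.exists_strict_hall hk hkn
  refine ⟨P, fun e => ?_⟩
  obtain ⟨π, hπ, hmem⟩ := (Finset.all_card_le_biUnion_card_iff_exists_injective
    (fun j : Fin k => (Finset.univ.filter fun i => P ∈ A i j).erase e)).mp (by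
      intro J
      rcases J.eq_empty_or_nonempty with rfl | hJ
      · simp
      -- Reinserting `e` restores all guests liking a piece of `J`; the strict inequality pays for
      -- this one extra element.
      · have h := hP J hJ (insert e (J.biUnion fun j =>
          (Finset.univ.filter fun i => P ∈ A i j).erase e)) (by
            intro i j hj hPA
            by_cases hie : i = e
            · simp [hie]
            · refine Finset.mem_insert_of_mem (Finset.mem_biUnion.mpr ⟨j, hj, ?_⟩)
              simp [hie, hPA])
        exact Nat.lt_succ_iff.mp (h.trans_le (Finset.card_insert_le _ _)))
  refine ⟨π, hπ, fun j => ?_⟩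
  have := hmem j
  simp only [Finset.mem_erase, Finset.mem_filter, Finset.mem_univ, true_and] at this
  exact ⟨by simpa using this.1, this.2⟩
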